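/- Rings are commutative with unit. For a ring extension $R\subseteq S$, let $[R,S]$ be the set of rings $T$ with $R\subseteq T\subseteq S$. The extension is \emph{FCP} if every chain in $[R,S]$ is finite; it is a \emph{QR-extension} if every $T\in[R,S]$ is isomorphic, as an $R$-algebra, to a localization $R_\Sigma$ for some multiplicatively closed subset $\Sigma\subseteq R$; it is \emph{Prüfer} if $R\subseteq T$ is a flat epimorphism for every $T\in[R,S]$. A \emph{Prüfer minimal} extension is an extension $A\subset B$ with $A\neq B$ and $[A,B]=\{A,B\}$ that is a flat epimorphism. A \emph{locally strong divisor} of $R$ is a regular element $x\in R$ such that $R\subseteq R_x$ is Prüfer. Theorem. Let $R\subseteq S$ be a QR-extension that has FCP. Then there are an integer $n\geq 0$, a tower of Prüfer minimal extensions $$R=R_0\subset R_1\subset\cdots\subset R_n=S$$ and locally strong divisors $a_1,\dots,a_n\in R$ such that $R_i=(R_{i-1})_{a_i}=R_{a_i}$ for $1\le i\le n$, $S=R_{a_1\cdots a_n}$ and, if $n\geq 1$, $S=R_{a_n}$. Moreover, every tower of Prüfer minimal extensions from $R$ to $S$ has the same length $n=|\mathrm{Supp}_R(S/R)|$; in particular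 this support is finite. -/

import Mathlib

/-- `f` is a flat epimorphism of commutative rings. -/
def IsFlatEpimorphism {A B : Type*} [CommRing A] [CommRing B] (f : A →+* B) : Prop :=
  f.Flat ∧ (letI : Algebra A B := f.toAlgebra; Algebra.IsEpi A B)

/-- `f` presents `A ⊂ B` as a minimal extension: it is injective, not surjective, and the only
rings between `A` and `B` are `A` and `B`. -/
def IsMinimalExtension {A B : Type*} [CommRing A] [CommRing B] (f : A →+* B) : Prop :=
  Function.Injective f ∧ f.range ≠ ⊤ ∧
    ∀ C : Subring B, f.range ≤ C → C = f.range ∨ C = ⊤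

/-- A Prüfer minimal extension: a minimal extension that is a flat epimorphism. -/
def IsPruferMinimalExtension {A B : Type*} [CommRing A] [CommRing B] (f : A →+* B) : Prop :=
  IsMinimalExtension f ∧ IsFlatEpimorphism f

/-- `f : A → B` identifies `B` with the localization `A_x`. -/
def IsLocalizationAwayHom {A B : Type*} [CommRing A] [CommRing B] (f : A →+* B) (x : A) : Prop :=
  letI : Algebra A B := f.toAlgebra
  IsLocalization.Away x B

section

variable (R S : Type*) [CommRing R] [CommRing S] [Algebra R S]

/-- `R ⊆ S` is a Prüfer extension: `R ⊆ T` is a flat epimorphism for every intermediate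
ring `T`. -/
def IsPruferExtension : Prop :=
  Function.Injective (algebraMap R S) ∧
    ∀ T : Subalgebra R S, IsFlatEpimorphism (algebraMap R T)

/-- `R ⊆ S` has FCP: every chain of intermediate rings is finite. -/
def HasFCP : Prop :=
  ∀ C : Set (Subalgebra R S), IsChain (· ≤ ·) C → C.Finite

/-- `R ⊆ S` is a QR-extension: every intermediate ring is, as an `R`-algebra, a localization of
`R` at a multiplicatively closed subset. -/
def IsQRExtension : Prop :=
  Function.Injective (algebraMap R S) ∧
    ∀ T : Subalgebra R S, ∃ M : Submonoid R, IsLocalization M T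

end

/-- A locally strong divisor: a regular element `x` such that `R ⊆ R_x` is Prüfer. -/
def IsLocallyStrongDivisor {R : Type*} [CommRing R] (x : R) : Prop :=
  IsRegular x ∧ IsPruferExtension R (Localization.Away x)

/-- `T 0 ⊂ T 1 ⊂ ⋯ ⊂ T n` is a tower of Prüfer minimal extensions from (the image of) `R`
to `S`. -/
structure IsPruferMinimalTower {R S : Type*} [CommRing R] [CommRing S] [Algebra R S]
    {n : ℕ} (T : Fin (n + 1) → Subalgebra R S) : Prop where
  bot : T 0 = ⊥
  top : T (Fin.last n) = ⊤
  step : ∀ i : Fin n, ∃ h : T i.castSucc ≤ T i.succ,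
    IsPruferMinimalExtension (Subalgebra.inclusion h).toRingHom

/-! FCP yields a finite maximal chain of intermediate rings. By QR each of them is some `R_M`, and
the ascending chain condition on the rings `R[1/m]`, `m ∈ M`, leaves a single `R_b`
(`IsQRExtension.exists_isLocalization_away`). So each covering pair is a localization at one
element, hence Prüfer minimal.

For the length, the support of `R_b / R` is `V(b)`, and each minimal step adds exactly one prime to
`V(b)`. The crux is `prime_le_of_isMinimalExtension_away`: let `x ∈ P ∩ Q` and `s ∈ Q \ P`.
Minimality forces `s` to be regular modulo `x`, and `A[s/x] = A_x`. Then `1/x ∈ A[s/x]` gives `x ^ k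
∈ (x, s) ^ (k + 1)`, and regularity turns this into `(x, s) = A`, which contradicts `x, s ∈ Q`. -/

open TensorProduct in
/-- A localization map is a flat epimorphism. -/
theorem isFlatEpimorphism_algebraMap {A B : Type*} [CommRing A] [CommRing B] [Algebra A B]
    (M : Submonoid A) [IsLocalization M B] : IsFlatEpimorphism (algebraMap A B) := by
  refine ⟨RingHom.flat_algebraMap_iff.mpr (IsLocalization.flat B M), ?_⟩
  have he : (algebraMap A B).toAlgebra = ‹Algebra A B› := Algebra.algebra_ext _ _ fun _ => rfl
  rw [he, Algebra.isEpi_iff_forall_one_tmul_eq]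
  intro z
  obtain ⟨⟨x, y⟩, hz⟩ := IsLocalization.surj M z
  obtain ⟨u, hu⟩ := (IsLocalization.map_units B y).exists_right_inv
  have hzu : z = x • u := by
    rw [Algebra.smul_def, ← hz, mul_assoc, hu, mul_one]
  have hxz : x • (1 : B) = y.1 • z := by
    rw [Algebra.smul_def, Algebra.smul_def, mul_one, ← hz, mul_comm]
  calc (1 : B) ⊗ₜ[A] z = (x • (1 : B)) ⊗ₜ[A] u := by
        rw [hzu, TensorProduct.smul_tmul]
    _ = z ⊗ₜ[A] (y.1 • u) := by rw [hxz, TensorProduct.smul_tmul]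
    _ = z ⊗ₜ[A] 1 := by rw [Algebra.smul_def, hu]

/-- A localization `B` of `R` is also a localization of any ring `A` between `R` and `B`. -/
theorem IsLocalization.Away.of_injective_tower {R A B : Type*} [CommRing R] [CommRing A]
    [CommRing B] [Algebra R A] [Algebra R B] [Algebra A B] [IsScalarTower R A B] (r : R)
    [IsLocalization.Away r B] (hinj : Function.Injective (algebraMap A B)) :
    IsLocalization.Away (algebraMap R A r) B := by
  refine IsLocalization.Away.mk _ ?_ (fun s => ?_) fun a b hab => ⟨0, by rw [hinj hab]⟩
  · rw [← IsScalarTower.algebraMap_apply]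
    exact IsLocalization.Away.algebraMap_isUnit r
  · obtain ⟨n, a, h⟩ := IsLocalization.Away.surj r s
    refine ⟨n, algebraMap R A a, ?_⟩
    rw [← IsScalarTower.algebraMap_apply, ← IsScalarTower.algebraMap_apply, h]

/-! ### Powers of `(x, s)` and denominators in `A[s/x]` -/

/-- Every monomial of degree `k + 1` in `x, s` other than `s ^ (k + 1)` is `x` times one of degree
`k`. -/
theorem Ideal.span_pair_pow_succ_le {A : Type*} [CommRing A] (x s : A) (k : ℕ) :
    Ideal.span {x, s} ^ (k + 1) ≤
      Ideal.span {x} * Ideal.span {x, s} ^ k ⊔ Ideal.span {s ^ (k + 1)} := by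
  induction k with
  | zero => simp [← Ideal.span_insert]
  | succ k ih =>
    have hx : Ideal.span {x} ≤ Ideal.span {x, s} := Ideal.span_mono (by simp)
    have hs : Ideal.span {s ^ (k + 1)} ≤ Ideal.span {x, s} ^ (k + 1) := by
      rw [Ideal.span_singleton_le_iff_mem]
      exact Ideal.pow_mem_pow (Ideal.subset_span (by simp)) _
    calc Ideal.span {x, s} ^ (k + 1 + 1)
        ≤ (Ideal.span {x} * Ideal.span {x, s} ^ k ⊔ Ideal.span {s ^ (k + 1)}) *
            Ideal.span {x, s} := by rw [pow_succ]; exact Ideal.mul_mono_left ih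
      _ ≤ _ := by
        rw [Ideal.sup_mul, mul_assoc, ← pow_succ]
        refine sup_le le_sup_left ?_
        conv_lhs => rw [Ideal.span_insert x {s}, Ideal.mul_sup, mul_comm]
        refine sup_le (le_sup_of_le_left (Ideal.mul_mono_right hs)) (le_sup_of_le_right ?_)
        rw [Ideal.span_singleton_mul_span_singleton, ← pow_succ]

/-- If `s` is a nonzerodivisor modulo the regular element `x` and some `x ^ k` lies in
`(x, s) ^ (k + 1)`, then `x` and `s` generate the unit ideal. -/
theorem Ideal.span_pair_eq_top_of_pow_mem {A : Type*} [CommRing A] {x s : A}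
    (hx : IsRegular x) (hs : ∀ c, x ∣ s * c → x ∣ c) (k : ℕ)
    (hk : x ^ k ∈ Ideal.span {x, s} ^ (k + 1)) : Ideal.span {x, s} = ⊤ := by
  induction k with
  | zero => simpa [Ideal.eq_top_iff_one] using hk
  | succ k ih =>
    obtain ⟨y, hy, z, hz, hyz⟩ :=
      Submodule.mem_sup.mp (Ideal.span_pair_pow_succ_le x s (k + 1) hk)
    obtain ⟨j, hj, rfl⟩ := Ideal.mem_span_singleton_mul.mp hy
    obtain ⟨c, rfl⟩ := Ideal.mem_span_singleton'.mp hz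
    have hpow : ∀ (m : ℕ) (c : A), x ∣ s ^ m * c → x ∣ c := by
      intro m
      induction m with
      | zero => intro c h; simpa using h
      | succ m ihm => intro c h; exact ihm c (hs _ (by rwa [pow_succ', mul_assoc] at h))
    -- Here `x ^ (k + 1) = x * j + c * s ^ (k + 2)`, and powers of `s` are regular modulo `x`.
    -- Cancelling `x` then lowers the exponent.
    obtain ⟨c', rfl⟩ : x ∣ c := by
      refine hpow (k + 1 + 1) c ⟨x ^ k - j, ?_⟩
      linear_combination hyz
    refine ih ?_
    have : x ^ k = j + c' * s ^ (k + 1 + 1) := by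
      apply hx.left
      simp only
      linear_combination -hyz
    rw [this]
    refine Ideal.add_mem _ hj (Ideal.mul_mem_left _ _ (Ideal.pow_le_pow_right (Nat.le_succ _) ?_))
    exact Ideal.pow_mem_pow (Ideal.subset_span (by simp)) _

/-- With `u = s/x`, multiplying a polynomial of degree `k` in `u` by `x ^ k` homogenizes it to a
form of degree `k` in `x, s`. -/
theorem exists_pow_mul_mem_span_pair_pow {A B : Type*} [CommRing A] [CommRing B] [Algebra A B]
    {x s : A} {u b : B} (hu : algebraMap A B x * u = algebraMap A B s)
    (hb : b ∈ Algebra.adjoin A {u}) :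
    ∃ k, ∃ a ∈ Ideal.span {x, s} ^ k, algebraMap A B x ^ k * b = algebraMap A B a := by
  have hxk : ∀ k, x ^ k ∈ Ideal.span {x, s} ^ k := fun k =>
    Ideal.pow_mem_pow (Ideal.subset_span (by simp)) _
  induction hb using Algebra.adjoin_induction with
  | mem y hy =>
    obtain rfl : y = u := hy
    exact ⟨1, s, by simpa using Ideal.subset_span (by simp), by simpa using hu⟩
  | algebraMap r => exact ⟨0, r, by simp, by simp⟩
  | add y z _ _ hy hz =>
    obtain ⟨k, a, ha, hka⟩ := hy
    obtain ⟨l, c, hc, hlc⟩ := hz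
    refine ⟨k + l, x ^ l * a + x ^ k * c, Ideal.add_mem _ ?_ ?_, ?_⟩
    · rw [pow_add, mul_comm (x ^ l)]; exact Ideal.mul_mem_mul ha (hxk l)
    · rw [pow_add]; exact Ideal.mul_mem_mul (hxk k) hc
    · simp only [map_add, map_mul, map_pow, ← hka, ← hlc]; ring
  | mul y z _ _ hy hz =>
    obtain ⟨k, a, ha, hka⟩ := hy
    obtain ⟨l, c, hc, hlc⟩ := hz
    refine ⟨k + l, a * c, by rw [pow_add]; exact Ideal.mul_mem_mul ha hc, ?_⟩
    rw [map_mul, ← hka, ← hlc]; ring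

theorem IsLocalization.Away.isRegular_of_injective {A B : Type*} [CommRing A] [CommRing B]
    [Algebra A B] (x : A) [IsLocalization.Away x B]
    (hinj : Function.Injective (algebraMap A B)) : IsRegular x := by
  refine isRegular_iff_mem_nonZeroDivisors.mpr (mem_nonZeroDivisors_iff_right.mpr fun z hz => ?_)
  apply hinj
  rw [map_zero, ← (IsLocalization.Away.algebraMap_isUnit (S := B) x).mul_left_eq_zero, ← map_mul,
    hz, map_zero]

/-! ### Primes containing `x` and the support of `A_x / A` -/

/-- If `A ⊂ A_x` is a minimal extension, then at most one prime of `A` contains `x`. -/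
theorem prime_le_of_isMinimalExtension_away {A B : Type*} [CommRing A] [CommRing B] [Algebra A B]
    (x : A) [IsLocalization.Away x B] (hmin : IsMinimalExtension (algebraMap A B))
    (P Q : Ideal A) [P.IsPrime] [Q.IsPrime] (hP : x ∈ P) (hQ : x ∈ Q) : Q ≤ P := by
  obtain ⟨hinj, -, hC⟩ := hmin
  have hreg : IsRegular x := IsLocalization.Away.isRegular_of_injective (B := B) x hinj
  obtain ⟨v, hv⟩ := (IsLocalization.Away.algebraMap_isUnit (S := B) x).exists_right_inv
  have hmul : ∀ a c : A, algebraMap A B a * v = algebraMap A B c ↔ a = x * c := by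
    intro a c
    constructor
    · intro h
      apply hinj
      rw [map_mul, ← h]
      linear_combination (-algebraMap A B a) * hv
    · rintro rfl
      rw [map_mul]
      linear_combination (algebraMap A B c) * hv
  -- The elements with a denominator outside `P`. It omits `v = 1/x`, since `t/x ∈ A` forces `t ∈ xA
  -- ⊆ P`; by minimality it is `A`.
  let C : Subring B :=
    { carrier := {b | ∃ t ∉ P, ∃ a, algebraMap A B t * b = algebraMap A B a}
      mul_mem' := by
        rintro b c ⟨t, ht, a, hta⟩ ⟨t', ht', a', hta'⟩
        refine ⟨t * t', fun h => (‹P.IsPrime›.mem_or_mem h).elim ht ht', a * a', ?_⟩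
        rw [map_mul, map_mul, ← hta, ← hta']; ring
      one_mem' := ⟨1, ‹P.IsPrime›.one_notMem, 1, by simp⟩
      add_mem' := by
        rintro b c ⟨t, ht, a, hta⟩ ⟨t', ht', a', hta'⟩
        refine ⟨t * t', fun h => (‹P.IsPrime›.mem_or_mem h).elim ht ht', t' * a + t * a', ?_⟩
        rw [map_mul, map_add, map_mul, map_mul, ← hta, ← hta']; ring
      zero_mem' := ⟨1, ‹P.IsPrime›.one_notMem, 0, by simp⟩
      neg_mem' := by
        rintro b ⟨t, ht, a, hta⟩
        exact ⟨t, ht, -a, by rw [map_neg, ← hta]; ring⟩ }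
  have hCbot : C = (algebraMap A B).range := by
    refine (hC C ?_).resolve_right fun htop => ?_
    · rintro _ ⟨a, rfl⟩
      exact ⟨1, ‹P.IsPrime›.one_notMem, a, by simp⟩
    · obtain ⟨t, ht, a, hta⟩ : v ∈ C := htop ▸ Subring.mem_top v
      rw [(hmul t a).mp hta] at ht
      exact ht (P.mul_mem_right _ hP)
  intro s hsQ
  by_contra hsP
  -- If `s * c = x * d`, then `c/x` has denominator `s ∉ P`, so it lies in `C = A`.
  have hs : ∀ c, x ∣ s * c → x ∣ c := by
    rintro c ⟨d, hd⟩
    have hmem : algebraMap A B c * v ∈ C := by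
      refine ⟨s, hsP, d, ?_⟩
      rw [← mul_assoc, ← map_mul, hmul, hd]
    rw [hCbot] at hmem
    obtain ⟨e, he⟩ := hmem
    exact ⟨e, (hmul _ _).mp he.symm⟩
  have hv_notMem : ∀ c, x ∣ c → c = 1 → False := by
    rintro _ h rfl
    exact ‹P.IsPrime›.one_notMem (P.mem_of_dvd h hP)
  set u : B := algebraMap A B s * v with hu
  have hux : algebraMap A B x * u = algebraMap A B s := by
    rw [hu]; linear_combination (algebraMap A B s) * hv
  have htop : (Algebra.adjoin A {u}).toSubring = ⊤ := by
    refine (hC _ ?_).resolve_left fun hbot => ?_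
    · rintro _ ⟨a, rfl⟩
      exact (Algebra.adjoin A {u}).algebraMap_mem a
    · have hmem : u ∈ (Algebra.adjoin A {u}).toSubring := Algebra.subset_adjoin rfl
      rw [hbot] at hmem
      obtain ⟨e, he⟩ := hmem
      exact hsP (by rw [(hmul s e).mp he.symm]; exact P.mul_mem_right _ hP)
  have hvmem : v ∈ Algebra.adjoin A {u} := by
    have : v ∈ (Algebra.adjoin A {u}).toSubring := htop ▸ Subring.mem_top v
    exact this
  obtain ⟨k, a, ha, hka⟩ := exists_pow_mul_mem_span_pair_pow hux hvmem
  rw [← map_pow, hmul] at hka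
  have hspan : Ideal.span {x, s} = ⊤ := by
    cases k with
    | zero => exact (hv_notMem (x * a) (dvd_mul_right _ _) (by simpa using hka.symm)).elim
    | succ k =>
      refine Ideal.span_pair_eq_top_of_pow_mem hreg hs k ?_
      rwa [hreg.left (show x * x ^ k = x * a by rw [← hka, pow_succ'])]
  refine ‹Q.IsPrime›.ne_top (top_le_iff.mp (hspan ▸ Ideal.span_le.mpr ?_))
  rintro y (rfl | rfl) <;> assumption

/-- The support of `A_x / A` is the closed set defined by `x`. -/
theorem support_quotient_range_away {A B : Type*} [CommRing A] [CommRing B] [Algebra A B]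
    (x : A) [IsLocalization.Away x B] (hinj : Function.Injective (algebraMap A B)) :
    Module.support A (B ⧸ LinearMap.range (Algebra.linearMap A B)) =
      PrimeSpectrum.zeroLocus {x} := by
  ext p
  rw [PrimeSpectrum.mem_zeroLocus, Set.singleton_subset_iff, SetLike.mem_coe]
  constructor
  · intro hp
    by_contra hx
    revert hp
    rw [imp_false, Module.notMem_support_iff']
    intro m
    obtain ⟨b, rfl⟩ := Submodule.Quotient.mk_surjective _ m
    obtain ⟨n, a, hn⟩ := IsLocalization.Away.surj x b
    refine ⟨x ^ n, fun h => hx (p.2.mem_of_pow_mem n h), ?_⟩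
    rw [← Submodule.Quotient.mk_smul, Submodule.Quotient.mk_eq_zero]
    exact ⟨a, by rw [Algebra.linearMap_apply, ← hn, Algebra.smul_def, map_pow, mul_comm]⟩
  · intro hx
    obtain ⟨v, hv⟩ := (IsLocalization.Away.algebraMap_isUnit (S := B) x).exists_right_inv
    rw [Module.mem_support_iff']
    refine ⟨Submodule.Quotient.mk v, fun r hr h => hr ?_⟩
    rw [← Submodule.Quotient.mk_smul, Submodule.Quotient.mk_eq_zero] at h
    obtain ⟨c, hc⟩ := h
    rw [Algebra.linearMap_apply, Algebra.smul_def] at hc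
    have : r = x * c := hinj (by rw [map_mul, hc]; linear_combination (-algebraMap A B r) * hv)
    rw [this]
    exact p.asIdeal.mul_mem_right _ hx

/-! ### Chain conditions and intermediate rings `R_a` -/

theorem HasFCP.wellFoundedGT {R S : Type*} [CommRing R] [CommRing S] [Algebra R S]
    (h : HasFCP R S) : WellFoundedGT (Subalgebra R S) := by
  refine ⟨RelEmbedding.wellFounded_iff_isEmpty.mpr ⟨fun f => ?_⟩⟩
  have hf : StrictMono f := fun _ _ hab => f.map_rel_iff.mpr hab
  exact Set.infinite_range_of_injective hf.injective (h _ hf.monotone.isChain_range)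

theorem HasFCP.wellFoundedLT {R S : Type*} [CommRing R] [CommRing S] [Algebra R S]
    (h : HasFCP R S) : WellFoundedLT (Subalgebra R S) := by
  refine ⟨RelEmbedding.wellFounded_iff_isEmpty.mpr ⟨fun f => ?_⟩⟩
  have hf : StrictAnti f := fun _ _ hab => f.map_rel_iff.mpr hab
  exact Set.infinite_range_of_injective hf.injective (h _ hf.antitone.isChain_range)

/-- In a QR-extension with FCP every intermediate ring is obtained by inverting one element. -/
theorem IsQRExtension.exists_isLocalization_away {R S : Type*} [CommRing R] [CommRing S]
    [Algebra R S] (hQR : IsQRExtension R S) (hFCP : HasFCP R S) (T : Subalgebra R S) :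
    ∃ a : R, IsLocalization.Away a T := by
  obtain ⟨M, hM⟩ := hQR.2 T
  have := hFCP.wellFoundedGT
  choose v hv using fun m : M => (IsLocalization.map_units T m).exists_right_inv
  have hv' : ∀ m : M, algebraMap R S m * (v m : S) = 1 := fun m => congrArg Subtype.val (hv m)
  -- `R[1/m]` is chosen maximal; since `R[1/m] ⊆ R[1/(mm')]`, it contains every `1/m'`.
  obtain ⟨_, ⟨m, rfl⟩, hmax⟩ := wellFounded_gt.has_min
    (Set.range fun m : M => Algebra.adjoin R {(v m : S)}) (Set.range_nonempty _)
  have hinj : Function.Injective (algebraMap R T) := fun a b hab =>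
    hQR.1 (congrArg Subtype.val hab)
  have hle : ∀ m m' : M, (v m' : S) ∈ Algebra.adjoin R {(v (m * m') : S)} := by
    intro m m'
    have : (v m' : S) = m.1 • (v (m * m') : S) := by
      have h1 := hv' m'
      have h2 := hv' (m * m')
      rw [Submonoid.coe_mul, map_mul] at h2
      rw [Algebra.smul_def]
      linear_combination (algebraMap R S m * (v (m * m') : S)) * h1 - (v m' : S) * h2
    rw [this]
    exact Subalgebra.smul_mem _ (Algebra.self_mem_adjoin_singleton R (v (m * m') : S)) m.1
  have key : ∀ m' : M, (v m' : S) ∈ Algebra.adjoin R {(v m : S)} := by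
    intro m'
    have hsub : Algebra.adjoin R {(v m : S)} ≤ Algebra.adjoin R {(v (m * m') : S)} := by
      rw [Algebra.adjoin_le_iff, Set.singleton_subset_iff, mul_comm]
      exact hle m' m
    have heq := eq_of_le_of_not_lt hsub (hmax _ ⟨m * m', rfl⟩)
    rw [heq]
    exact hle m m'
  have hpow : ∀ b ∈ Algebra.adjoin R {(v m : S)}, ∃ (n : ℕ) (a : R),
      b * algebraMap R S m ^ n = algebraMap R S a := by
    intro b hb
    -- For `s = 1` the ideal condition is vacuous; only the cleared denominator `m ^ k` is needed.
    obtain ⟨k, a, -, h⟩ := exists_pow_mul_mem_span_pair_pow (x := m.1) (s := 1)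
      (by rw [hv' m, map_one]) hb
    exact ⟨k, a, by rw [mul_comm, h]⟩
  refine ⟨m, IsLocalization.Away.mk _ (IsLocalization.map_units T m) (fun s => ?_)
    fun a b hab => ⟨0, by rw [hinj hab]⟩⟩
  obtain ⟨⟨r, m'⟩, hs⟩ := IsLocalization.surj M s
  have hs' : (s : S) = r • (v m' : S) := by
    have h1 : (s : S) * algebraMap R S m' = algebraMap R S r := congrArg Subtype.val hs
    rw [Algebra.smul_def, ← h1]
    linear_combination (-(s : S)) * hv' m'
  obtain ⟨n, a, h⟩ := hpow s (by rw [hs']; exact Subalgebra.smul_mem _ (key m') r)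
  exact ⟨n, a, Subtype.ext h⟩

/-- If `R ⊆ S` is a QR-extension and `R_a` embeds in `S`, then `a` is a locally strong divisor. -/
theorem IsQRExtension.isLocallyStrongDivisor {R S : Type*} [CommRing R] [CommRing S]
    [Algebra R S] (hQR : IsQRExtension R S) (T : Subalgebra R S) (a : R)
    [IsLocalization.Away a T] : IsLocallyStrongDivisor a := by
  have hinj : Function.Injective (algebraMap R T) := fun a b hab =>
    hQR.1 (congrArg Subtype.val hab)
  let e : Localization.Away a ≃ₐ[R] T := IsLocalization.algEquiv (Submonoid.powers a) _ _
  refine ⟨IsLocalization.Away.isRegular_of_injective (B := T) a hinj, fun x y hxy => ?_,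
    fun U => ?_⟩
  · apply hinj
    rw [← e.commutes, ← e.commutes, hxy]
  · let f : Localization.Away a →ₐ[R] S := T.val.comp e.toAlgHom
    have hf : Function.Injective f := Subtype.val_injective.comp e.injective
    obtain ⟨M, hM⟩ := hQR.2 (U.map f)
    have := IsLocalization.isLocalization_of_algEquiv M (U.equivMapOfInjective f hf).symm
    exact isFlatEpimorphism_algebraMap M

/-! ### Covering pairs, towers and their length -/

/-- A covering pair of subalgebras is a minimal extension. -/
theorem isMinimalExtension_inclusion_of_covBy {R S : Type*} [CommRing R] [CommRing S]
    [Algebra R S] {T U : Subalgebra R S} (h : T ⋖ U) :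
    IsMinimalExtension (Subalgebra.inclusion h.le).toRingHom := by
  refine ⟨Subalgebra.inclusion_injective _, fun htop => h.lt.not_ge fun x hx => ?_,
    fun C hC => ?_⟩
  · obtain ⟨y, hy⟩ : (⟨x, hx⟩ : U) ∈ (Subalgebra.inclusion h.le).toRingHom.range :=
      htop ▸ Subring.mem_top _
    have : (y : S) = x := congrArg Subtype.val hy
    exact this ▸ y.2
  · have hCT : ∀ t (ht : t ∈ T), (⟨t, h.le ht⟩ : U) ∈ C := fun t ht => hC ⟨⟨t, ht⟩, rfl⟩
    -- Minimality concerns subrings and covering concerns `R`-subalgebras; a subring containing `T`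
    -- contains the image of `R`.
    let D : Subalgebra R S :=
      { C.map U.val.toRingHom with
        algebraMap_mem' := fun r => ⟨algebraMap R U r, hCT _ (T.algebraMap_mem r), rfl⟩ }
    have hTD : T ≤ D := fun t ht => ⟨⟨t, h.le ht⟩, hCT t ht, rfl⟩
    have hDU : D ≤ U := by rintro _ ⟨y, -, rfl⟩; exact y.2
    rcases h.eq_or_eq hTD hDU with hD | hD
    · refine Or.inl (le_antisymm (fun c hc => ?_) hC)
      have : (c : S) ∈ T := hD ▸ (⟨c, hc, rfl⟩ : (c : S) ∈ D)
      exact ⟨⟨c, this⟩, rfl⟩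
    · refine Or.inr (top_le_iff.mp fun c _ => ?_)
      have hc : (c : S) ∈ D := by rw [hD]; exact c.2
      obtain ⟨y, hy, hyc⟩ := hc
      exact (Subtype.ext hyc : y = c) ▸ hy

theorem isLocalizationAwayHom_inclusion {R S : Type*} [CommRing R] [CommRing S] [Algebra R S]
    {T U : Subalgebra R S} (h : T ≤ U) (a : R) [IsLocalization.Away a U] :
    IsLocalizationAwayHom (Subalgebra.inclusion h).toRingHom (algebraMap R T a) := by
  let : Algebra T U := (Subalgebra.inclusion h).toRingHom.toAlgebra
  have : IsScalarTower R T U := IsScalarTower.of_algebraMap_eq fun _ => rfl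
  exact IsLocalization.Away.of_injective_tower a (Subalgebra.inclusion_injective h)

theorem isFlatEpimorphism_inclusion {R S : Type*} [CommRing R] [CommRing S] [Algebra R S]
    {T U : Subalgebra R S} (h : T ≤ U) (a : R) [IsLocalization.Away a U] :
    IsFlatEpimorphism (Subalgebra.inclusion h).toRingHom := by
  let : Algebra T U := (Subalgebra.inclusion h).toRingHom.toAlgebra
  have : IsLocalization.Away (algebraMap R T a) U := isLocalizationAwayHom_inclusion h a
  exact isFlatEpimorphism_algebraMap (B := U) (Submonoid.powers (algebraMap R T a))

/-- Along a minimal extension `R_a ⊂ R_b` the closed set `V(b)` is `V(a)` and one more prime. -/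
theorem exists_zeroLocus_eq_insert {R S : Type*} [CommRing R] [CommRing S] [Algebra R S]
    {T U : Subalgebra R S} (h : T ≤ U) (a b : R) [IsLocalization.Away a T]
    [IsLocalization.Away b U]
    (hmin : IsMinimalExtension (Subalgebra.inclusion h).toRingHom) :
    ∃ p ∉ PrimeSpectrum.zeroLocus {a},
      PrimeSpectrum.zeroLocus {b} = insert p (PrimeSpectrum.zeroLocus {a}) := by
  let : Algebra T U := (Subalgebra.inclusion h).toRingHom.toAlgebra
  have hloc : IsLocalization.Away (algebraMap R T b) U := isLocalizationAwayHom_inclusion h b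
  have hmem : ∀ (r : R) (p : PrimeSpectrum R),
      p ∈ PrimeSpectrum.zeroLocus {r} ↔ r ∈ p.asIdeal := fun r p => by
    rw [PrimeSpectrum.mem_zeroLocus, Set.singleton_subset_iff, SetLike.mem_coe]
  have hnu : ¬ IsUnit (algebraMap R T b) := by
    intro hu
    obtain ⟨-, hne, -⟩ := hmin
    refine hne (top_le_iff.mp fun x _ => ?_)
    obtain ⟨y, rfl⟩ := (IsLocalization.atUnit T U (algebraMap R T b) hu).surjective x
    exact ⟨y, ((IsLocalization.atUnit T U (algebraMap R T b) hu).commutes y).symm⟩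
  -- The contraction to `R` of a maximal ideal of `T` containing `b` is the new prime.
  obtain ⟨N, hNmax, hN⟩ := exists_max_ideal_of_mem_nonunits hnu
  let q : PrimeSpectrum T := ⟨N, hNmax.isPrime⟩
  have hrange := PrimeSpectrum.localization_away_comap_range T a
  have hrange' : ∀ p : PrimeSpectrum R, a ∉ p.asIdeal ↔
      ∃ q : PrimeSpectrum T, PrimeSpectrum.comap (algebraMap R T) q = p := fun p =>
    (Set.ext_iff.mp hrange p).symm
  refine ⟨PrimeSpectrum.comap (algebraMap R T) q, ?_, ?_⟩
  · rw [hmem]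
    exact (hrange' _).mpr ⟨q, rfl⟩
  · ext p
    rw [Set.mem_insert_iff, hmem, hmem]
    constructor
    · intro hb
      by_cases ha : a ∈ p.asIdeal
      · exact Or.inr ha
      · obtain ⟨q', rfl⟩ := (hrange' p).mp ha
        have hb' : algebraMap R T b ∈ q'.asIdeal := hb
        left
        congr 1
        refine PrimeSpectrum.ext (le_antisymm ?_ ?_)
        · exact prime_le_of_isMinimalExtension_away (B := U) (algebraMap R T b) hmin _ _ hN hb'
        · exact prime_le_of_isMinimalExtension_away (B := U) (algebraMap R T b) hmin _ _ hb' hN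
    · rintro (rfl | ha)
      · exact hN
      · have hu : IsUnit (algebraMap R U a) :=
          (IsLocalization.Away.algebraMap_isUnit (S := T) a).map (Subalgebra.inclusion h)
        obtain ⟨v, hv⟩ := hu.exists_right_inv
        by_contra hb
        obtain ⟨q', rfl⟩ : ∃ q' : PrimeSpectrum U,
            PrimeSpectrum.comap (algebraMap R U) q' = p :=
          (Set.ext_iff.mp (PrimeSpectrum.localization_away_comap_range U b) p).mpr hb
        have ha' : algebraMap R U a ∈ q'.asIdeal := ha
        exact q'.2.one_notMem (hv ▸ q'.asIdeal.mul_mem_right v ha')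

/-- The length of a tower of minimal extensions is the cardinality of the support. -/
theorem IsPruferMinimalTower.encard_support {R S : Type*} [CommRing R] [CommRing S]
    [Algebra R S] (hQR : IsQRExtension R S) (hFCP : HasFCP R S) {n : ℕ}
    {T : Fin (n + 1) → Subalgebra R S} (hT : IsPruferMinimalTower T) :
    (Module.support R (S ⧸ LinearMap.range (Algebra.linearMap R S))).encard = n := by
  choose b hb using fun i => hQR.exists_isLocalization_away hFCP (T i)
  have hcard : ∀ i : Fin (n + 1), (PrimeSpectrum.zeroLocus {b i}).encard = (i : ℕ) := by
    intro i
    induction i using Fin.induction with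
    | zero =>
      rw [Fin.val_zero, Nat.cast_zero, Set.encard_eq_zero, ← PrimeSpectrum.zeroLocus_span,
        PrimeSpectrum.zeroLocus_empty_iff_eq_top, Ideal.span_singleton_eq_top]
      obtain ⟨v, hv⟩ := (IsLocalization.Away.algebraMap_isUnit (S := T 0) (b 0)).exists_right_inv
      obtain ⟨c, hc⟩ := Algebra.mem_bot.mp (hT.bot ▸ v.2 : (v : S) ∈ (⊥ : Subalgebra R S))
      have hv' : algebraMap R S (b 0) * (v : S) = 1 := congrArg Subtype.val hv
      -- The inverse of `b 0` lies in `T 0 = ⊥`, so `b 0` is already a unit of `R` and `V(b 0)` is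
      -- empty.
      refine IsUnit.of_mul_eq_one c (hQR.1 ?_)
      rw [map_mul, hc, hv', map_one]
    | succ i ih =>
      obtain ⟨h, hmin, -⟩ := hT.step i
      obtain ⟨p, hp, heq⟩ := exists_zeroLocus_eq_insert h (b i.castSucc) (b i.succ) hmin
      rw [heq, Set.encard_insert_of_notMem hp, ih]
      simp
  have htop : IsLocalization.Away (b (Fin.last n)) S := by
    have h1 := hb (Fin.last n)
    rw [hT.top] at h1
    exact IsLocalization.isLocalization_of_algEquiv _ Subalgebra.topEquiv
  rw [support_quotient_range_away (b (Fin.last n)) hQR.1, hcard]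
  simp

/- With `i : Fin n`, the element `a i` is the one adjoined in passing from the `i`-th ring of the
tower to the next one, so `a 0, …, a (n - 1)` are the elements `a_1, …, a_n`. -/
theorem mainTheorem11 {R S : Type*} [CommRing R] [CommRing S] [Algebra R S]
    (hQR : IsQRExtension R S) (hFCP : HasFCP R S) :
    (∃ (n : ℕ) (T : Fin (n + 1) → Subalgebra R S) (a : Fin n → R),
      IsPruferMinimalTower T ∧
      (∀ i : Fin n, IsLocallyStrongDivisor (a i)) ∧
      (∀ i : Fin n, ∃ h : T i.castSucc ≤ T i.succ,
        IsLocalizationAwayHom (Subalgebra.inclusion h).toRingHom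
          (algebraMap R (T i.castSucc) (a i))) ∧
      (∀ i : Fin n, IsLocalization.Away (a i) (T i.succ)) ∧
      IsLocalization.Away (∏ i : Fin n, a i) S ∧
      (∀ i : Fin n, (i : ℕ) + 1 = n → IsLocalization.Away (a i) S)) ∧
    (∀ (n : ℕ) (T : Fin (n + 1) → Subalgebra R S), IsPruferMinimalTower T →
      (Module.support R (S ⧸ LinearMap.range (Algebra.linearMap R S))).encard = n) := by
  refine ⟨?_, fun n T hT => hT.encard_support hQR hFCP⟩
  have := hFCP.wellFoundedGT
  have := hFCP.wellFoundedLT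
  obtain ⟨c, hbot, n, htop, hcov⟩ :=
    exists_covBy_seq_of_wellFoundedLT_wellFoundedGT (Subalgebra R S)
  have hmono : ∀ i j, i ≤ j → j ≤ n → c i ≤ c j := by
    intro i j hij
    induction j, hij using Nat.le_induction with
    | base => exact fun _ => le_rfl
    | succ j _ ih => exact fun hj => (ih (by omega)).trans (hcov j (by omega)).le
  choose b hb using fun i => hQR.exists_isLocalization_away hFCP (c i)
  have htop' : ∀ i, c i = ⊤ → IsLocalization.Away (b i) S := by
    intro i hi
    have h1 := hb i
    rw [hi] at h1
    exact IsLocalization.isLocalization_of_algEquiv _ Subalgebra.topEquiv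
  have hn := htop' n htop.eq_top
  have hunit : ∀ i ≤ n, IsUnit (algebraMap R S (b i)) := fun i hi =>
    (IsLocalization.Away.algebraMap_isUnit (S := c i) (b i)).map (c i).val
  refine ⟨n, fun i => c i, fun i => b (i + 1), ⟨hbot.eq_bot, htop.eq_top, fun i => ?_⟩,
    fun i => hQR.isLocallyStrongDivisor (c (i + 1)) _,
    fun i => ⟨(hcov i i.2).le, ?_⟩, fun i => hb (i + 1), ?_, ?_⟩
  · exact ⟨(hcov i i.2).le, isMinimalExtension_inclusion_of_covBy (hcov i i.2),
      isFlatEpimorphism_inclusion (hcov i i.2).le (b (i + 1))⟩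
  · exact isLocalizationAwayHom_inclusion (hcov i i.2).le (b (i + 1))
  · cases n with
    | zero =>
      have h0 : c 0 = ⊤ := htop.eq_top
      rw [Fin.prod_univ_zero]
      refine IsLocalization.away_of_isUnit_of_bijective S isUnit_one ⟨hQR.1, fun s => ?_⟩
      exact Algebra.mem_bot.mp ((hbot.eq_bot.symm.trans h0).symm ▸ Algebra.mem_top)
    | succ n =>
      rw [Fin.prod_univ_castSucc]
      -- The earlier factors are already units in `S`, which is the localization at the last one.
      refine IsLocalization.Away.mul_of_isUnit' (S := S) _ (b (n + 1)) ?_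
      rw [map_prod, IsUnit.prod_univ_iff]
      exact fun i => hunit _ (by simp only [Fin.val_castSucc]; omega)
  · intro i hi
    exact htop' _ (by rw [hi]; exact htop.eq_top)
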